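/- Let $d,m\ge 1$, let $\Omega\subset\mathbb R^d$ be open, $A:\Omega\to\mathbb R^{d\times d}$, $B\in\mathbb R^{d\times m}$, let $Q\in\mathbb R^{d\times d}$ be symmetric positive semidefinite and $R\in\mathbb R^{m\times m}$ symmetric positive definite, and put $F=BR^{-1}B^\top$. Norms are the Euclidean norm of vectors and the operator 2-norm of matrices. A real square matrix is *stable* if all its eigenvalues have negative real part; $(A,B)$ is *stabilizable* if $A-BK$ is stable for some $K\in\mathbb R^{m\times d}$, and $(A,C)$ is *detectable* if $(A^\top,C^\top)$ is stabilizable. The logarithmic norm of $M\in\mathbb C^{d\times d}$ is $\mathrm{logm}(M)=\sup_{x\in\mathbb C^d\setminus\{0\}}\mathrm{Re}\,(x^*Mx)/\|x\|^2$. Assume that for every $x\in\Omega$ the pair $(A(x),B)$ is stabilizable and the pair $(A(x),Q^{1/2})$ is detectable. Let $P(x)$ be the unique symmetric positive semidefinite solution of the state-dependent Riccati equation (SDRE) $$A(x)^\top P+PA(x)-PFP+Q=0,$$ and let $A_{cl}(x)=A(x)-FP(x)$. Assume further that * $\|A(x)-A(x')\|\le L_A\|x-x'\|$ for all $x,x'\in\Omega$,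 with a constant $L_A>0$; * $A_{cl}$ is differentiable on $\Omega$, and $\mathrm{logm}(A_{cl}(x))+\mathrm{logm}((\nabla A_{cl}(x))x)<0$ for all $x\in\Omega$, where $(\nabla A_{cl}(x))x\in\mathbb R^{d\times d}$ is the matrix whose $j$-th column is $\big[\tfrac{\partial}{\partial x_j}A_{cl}(x)\big]x$. Let $t,\Delta t\ge 0$ and let $y:[0,t+\Delta t]\to\Omega$ solve $\dot y(s)=A_{cl}(y(s))\,y(s)$. Let $H_t$ be the solution of the Lyapunov equation $A_{cl}(y(t))^\top H_t+H_tA_{cl}(y(t))=-I$. If $$\Delta t<\frac{1}{2L_A\,\|A_{cl}(y(0))\,y(0)\|\,\|H_t\|}$$ (where $1/0=+\infty$), then $A(y(t+\Delta t))-FP(y(t))$ is stable. Moreover, the SDRE at the state $y(t+\Delta t)$ has a unique symmetric positive semidefinite solution $P(y(t+\Delta t))$, and there is exactly one Newton–Kleinman sequence $(P^k)_{k\ge0}$, that is, one sequence of real $d\times d$ matrices with $P^0=P(y(t))$ and $$(A(y(t+\Delta t))-FP^k)^\top P^{k+1}+P^{k+1}(A(y(t+\Delta t))-FP^k)=-P^kFP^k-Q,\qquad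 k\ge 0,$$ and it converges to $P(y(t+\Delta t))$. -/

import Mathlib

open Filter Topology
open scoped Matrix MatrixOrder Matrix.Norms.L2Operator

/-! Matrices carry the operator 2-norm (spectral norm), states carry the Euclidean norm. -/

namespace SDRE

/-- A real square matrix is stable if all its (complex) eigenvalues lie in the open left half
plane. -/
def Stable {d : ℕ} (M : Matrix (Fin d) (Fin d) ℝ) : Prop :=
  ∀ z ∈ spectrum ℂ (M.map Complex.ofReal), z.re < 0

/-- `(A, B)` is stabilizable if `A - B K` is stable for some feedback matrix `K`. -/
def Stabilizable {d m : ℕ} (A : Matrix (Fin d) (Fin d) ℝ) (B : Matrix (Fin d) (Fin m) ℝ) : Prop :=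
  ∃ K : Matrix (Fin m) (Fin d) ℝ, Stable (A - B * K)

/-- `(A, C)` is detectable if `(Aᵀ, Cᵀ)` is stabilizable. -/
def Detectable {d : ℕ} (A C : Matrix (Fin d) (Fin d) ℝ) : Prop :=
  Stabilizable Aᵀ Cᵀ

/-- `F = B R⁻¹ Bᵀ`. -/
noncomputable def gainF {d m : ℕ} (B : Matrix (Fin d) (Fin m) ℝ) (R : Matrix (Fin m) (Fin m) ℝ) :
    Matrix (Fin d) (Fin d) ℝ :=
  B * R⁻¹ * Bᵀ

/-- `P` is a symmetric positive semidefinite solution of the algebraic Riccati equation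
`Aᵀ P + P A - P F P + Q = 0`. -/
def IsRiccatiSol {d : ℕ} (A F Q P : Matrix (Fin d) (Fin d) ℝ) : Prop :=
  P.PosSemidef ∧ Aᵀ * P + P * A - P * F * P + Q = 0

/-- The symmetric positive semidefinite solution of the algebraic Riccati equation
(an arbitrary matrix if there is none). -/
noncomputable def riccatiSol {d : ℕ} (A F Q : Matrix (Fin d) (Fin d) ℝ) :
    Matrix (Fin d) (Fin d) ℝ :=
  Classical.epsilon (IsRiccatiSol A F Q)

/-- The solution `H` of the Lyapunov equation `Mᵀ H + H M = - I`
(an arbitrary matrix if there is none). -/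
noncomputable def lyapunovSol {d : ℕ} (M : Matrix (Fin d) (Fin d) ℝ) :
    Matrix (Fin d) (Fin d) ℝ :=
  Classical.epsilon fun H : Matrix (Fin d) (Fin d) ℝ => Mᵀ * H + H * M = -1

/-- The closed-loop matrix `A_cl(x) = A(x) - F P(x)`, where `P(x)` is the solution of the
state-dependent Riccati equation at the state `x`. -/
noncomputable def closedLoop {d : ℕ} (A : EuclideanSpace ℝ (Fin d) → Matrix (Fin d) (Fin d) ℝ)
    (F Q : Matrix (Fin d) (Fin d) ℝ) (x : EuclideanSpace ℝ (Fin d)) : Matrix (Fin d) (Fin d) ℝ :=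
  A x - F * riccatiSol (A x) F Q

/-- The vector `M x` as an element of Euclidean space. -/
def act {d : ℕ} (M : Matrix (Fin d) (Fin d) ℝ) (x : EuclideanSpace ℝ (Fin d)) :
    EuclideanSpace ℝ (Fin d) :=
  WithLp.toLp 2 (M *ᵥ x.ofLp)

/-- The matrix `(∇ G(x)) x`, whose `j`-th column is `(∂G/∂x_j)(x) x`. -/
noncomputable def gradMul {d : ℕ} (G : EuclideanSpace ℝ (Fin d) → Matrix (Fin d) (Fin d) ℝ)
    (x : EuclideanSpace ℝ (Fin d)) : Matrix (Fin d) (Fin d) ℝ :=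
  Matrix.of fun i j => (fderiv ℝ G x (EuclideanSpace.single j 1) *ᵥ x.ofLp) i

/-- The logarithmic norm: the supremum of `Re ((M x) · x) / ‖x‖²` over the nonzero complex
vectors `x`, with the Hermitian product. -/
noncomputable def logm {d : ℕ} (M : Matrix (Fin d) (Fin d) ℂ) : ℝ :=
  ⨆ x : {x : EuclideanSpace ℂ (Fin d) // x ≠ 0},
    (star x.1.ofLp ⬝ᵥ (M *ᵥ x.1.ofLp)).re / ‖x.1‖ ^ 2

/-- `X` is a sequence of Newton-Kleinman iterates for `Aᵀ P + P A - P F P + Q = 0` with initial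
guess `P₀`: each iterate solves the Lyapunov equation built from the previous one. -/
def IsNewtonKleinman {d : ℕ} (A F Q P₀ : Matrix (Fin d) (Fin d) ℝ)
    (X : ℕ → Matrix (Fin d) (Fin d) ℝ) : Prop :=
  X 0 = P₀ ∧ ∀ k, (A - F * X k)ᵀ * X (k + 1) + X (k + 1) * (A - F * X k) = -(X k * F * X k) - Q

end SDRE

/-! ### Stable matrices and Lyapunov equations. -/

namespace SDRE

variable {d : ℕ}

/-! Differentiating `v = G(y) y` along `y' = G(y) y` gives `v' = J v`, where `J` is `G` plus
`gradMul G`. The logarithmic-norm condition makes the symmetric part of `J` negative, so the speed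
never exceeds its initial value. Hence `y`, and through the Lipschitz bound `A`, moves by a
controlled amount over a time `Δt`. With the gain frozen, this change of `A` is a perturbation `E`
of the stable matrix `Acl (y t)`. The Lyapunov matrix `H_t` still certifies stability as long as `2
‖E‖ ‖H_t‖ < 1`, which the step-size condition ensures. The rest is Kleinman's theorem. From a
stabilizing symmetric start each Lyapunov equation is uniquely solvable, completing the square
together with detectability keeps every iterate stabilizing, and the iterates decrease from index 1
on, so they converge to a Riccati solution. Two positive semidefinite solutions dominate each other
and so coincide. The Lyapunov facts are obtained in discrete time: the Cayley transform `T` of a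
stable matrix satisfies `T ^ n → 0`, and iterating a Stein equation replaces the integral of matrix
exponentials. -/

theorem transpose_eq_of_posSemidef {n : Type*} {P : Matrix n n ℝ} (hP : P.PosSemidef) :
    Pᵀ = P := by
  rw [← Matrix.conjTranspose_eq_transpose_of_trivial]
  exact hP.isHermitian

theorem dotProduct_transpose_mul_mul_mulVec {n k : Type*} [Fintype n] [Fintype k]
    (S : Matrix k n ℝ) (X : Matrix k k ℝ) (z : n → ℝ) :
    z ⬝ᵥ ((Sᵀ * X * S) *ᵥ z) = (S *ᵥ z) ⬝ᵥ (X *ᵥ (S *ᵥ z)) := by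
  rw [← Matrix.mulVec_mulVec, ← Matrix.mulVec_mulVec, Matrix.dotProduct_transpose_mulVec,
    dotProduct_comm]

theorem mem_spectrum_iff_exists_eigenvector {K : Type*} [Field K] (M : Matrix (Fin d) (Fin d) K)
    (z : K) : z ∈ spectrum K M ↔ ∃ v : Fin d → K, v ≠ 0 ∧ M *ᵥ v = z • v := by
  rw [← Matrix.spectrum_toLin', ← Module.End.hasEigenvalue_iff_mem_spectrum]
  constructor
  · intro h
    obtain ⟨v, hv⟩ := h.exists_hasEigenvector
    exact ⟨v, hv.2, by simpa using hv.apply_eq_smul⟩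
  · rintro ⟨v, hv, h⟩
    refine Module.End.hasEigenvalue_of_hasEigenvector (x := v) ⟨?_, hv⟩
    rw [Module.End.mem_eigenspace_iff]
    simpa using h

/-- Gelfand's formula: the spectral radius is below some `r < 1`, so eventually `‖T ^ n‖ ≤ r ^ n`.
Dimension zero is separate because the spectral radius argument needs a nontrivial algebra. -/
theorem tendsto_pow_of_spectrum (T : Matrix (Fin d) (Fin d) ℂ)
    (hT : ∀ z ∈ spectrum ℂ T, ‖z‖ < 1) : Tendsto (fun n : ℕ => T ^ n) atTop (𝓝 0) := by
  rcases Nat.eq_zero_or_pos d with rfl | hd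
  · refine tendsto_const_nhds.congr fun n => ?_
    ext i
    exact i.elim0
  have : Nonempty (Fin d) := ⟨⟨0, hd⟩⟩
  have h1 : spectralRadius ℂ T < ((1 : NNReal) : ENNReal) :=
    spectrum.spectralRadius_lt_of_forall_lt T fun z hz => by
      rw [← NNReal.coe_lt_coe]
      simpa using hT z hz
  obtain ⟨r, hr, hr1⟩ := ENNReal.lt_iff_exists_nnreal_btwn.1 h1
  have h2 := (spectrum.pow_nnnorm_pow_one_div_tendsto_nhds_spectralRadius T).eventually
    (gt_mem_nhds hr)
  have hr1' : (r : ℝ) < 1 := by exact_mod_cast hr1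
  refine squeeze_zero_norm' ?_ (tendsto_pow_atTop_nhds_zero_of_lt_one r.2 hr1')
  filter_upwards [h2, eventually_gt_atTop 0] with n hn hn0
  have hn' : (0 : ℝ) < n := by exact_mod_cast hn0
  have h3 : (‖T ^ n‖₊ : ENNReal) ≤ (r : ENNReal) ^ (n : ℝ) := by
    rw [one_div] at hn
    exact (ENNReal.rpow_inv_le_iff hn').1 hn.le
  rw [ENNReal.rpow_natCast] at h3
  exact_mod_cast h3

theorem Stable.re_neg {M : Matrix (Fin d) (Fin d) ℝ} (h : Stable M) {v : Fin d → ℂ} (hv : v ≠ 0)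
    {z : ℂ} (hz : M.map Complex.ofReal *ᵥ v = z • v) : z.re < 0 :=
  h z ((mem_spectrum_iff_exists_eigenvector _ _).2 ⟨v, hv, hz⟩)

theorem map_ofReal_mulVec_eq_smul_iff (M : Matrix (Fin d) (Fin d) ℝ) (v : Fin d → ℂ) (z : ℂ) :
    M.map Complex.ofReal *ᵥ v = z • v ↔
      M *ᵥ (fun i => (v i).re) = z.re • (fun i => (v i).re) - z.im • (fun i => (v i).im) ∧
      M *ᵥ (fun i => (v i).im) = z.im • (fun i => (v i).re) + z.re • (fun i => (v i).im) := by
  simp only [funext_iff, Complex.ext_iff, forall_and]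
  refine and_congr (forall_congr' fun i => ?_) (forall_congr' fun i => ?_)
  · simp [Matrix.mulVec, dotProduct]
  · simp [Matrix.mulVec, dotProduct, add_comm]

/-- Splitting an eigenvector into real and imaginary parts lets later arguments use real quadratic
forms only. -/
theorem stable_iff {M : Matrix (Fin d) (Fin d) ℝ} :
    Stable M ↔ ∀ (α β : ℝ) (a b : Fin d → ℝ), (a ≠ 0 ∨ b ≠ 0) → M *ᵥ a = α • a - β • b →
      M *ᵥ b = β • a + α • b → α < 0 := by
  constructor
  · intro h α β a b hab ha hb
    have := h.re_neg (v := fun i => ⟨a i, b i⟩) (z := ⟨α, β⟩) ?_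
      ((map_ofReal_mulVec_eq_smul_iff _ _ _).2 ⟨ha, hb⟩)
    · exact this
    · intro h0
      rcases hab with h | h
      · exact h (funext fun i => congrArg Complex.re (congrFun h0 i))
      · exact h (funext fun i => congrArg Complex.im (congrFun h0 i))
  · intro h z hz
    obtain ⟨v, hv, hz⟩ := (mem_spectrum_iff_exists_eigenvector _ _).1 hz
    obtain ⟨h1, h2⟩ := (map_ofReal_mulVec_eq_smul_iff _ _ _).1 hz
    refine h _ _ _ _ ?_ h1 h2
    by_contra! h0
    exact hv (funext fun i => Complex.ext (congrFun h0.1 i) (congrFun h0.2 i))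

theorem spectrum_transpose {K : Type*} [Field K] (M : Matrix (Fin d) (Fin d) K) :
    spectrum K Mᵀ = spectrum K M := by
  ext z
  rw [spectrum.mem_iff, spectrum.mem_iff, Matrix.isUnit_iff_isUnit_det,
    Matrix.isUnit_iff_isUnit_det (_ - M), ← Matrix.det_transpose (_ - M), Matrix.transpose_sub,
    Matrix.algebraMap_eq_diagonal, Matrix.diagonal_transpose]

theorem Stable.transpose {M : Matrix (Fin d) (Fin d) ℝ} (h : Stable M) : Stable Mᵀ := by
  intro z hz
  rw [Matrix.transpose_map, spectrum_transpose] at hz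
  exact h z hz

theorem Stable.isUnit_one_sub {M : Matrix (Fin d) (Fin d) ℝ} (h : Stable M) :
    IsUnit (1 - M) := by
  rw [Matrix.isUnit_iff_isUnit_det, isUnit_iff_ne_zero]
  intro h0
  obtain ⟨v, hv, h1⟩ := Matrix.exists_mulVec_eq_zero_iff.2 h0
  rw [Matrix.sub_mulVec, Matrix.one_mulVec, sub_eq_zero] at h1
  have := stable_iff.1 h 1 0 v 0 (Or.inl hv) (by simp [← h1]) (by simp)
  linarith

/-- The Cayley transform of a stable matrix is power-convergent to zero. -/
theorem Stable.tendsto_cayley_pow {M N : Matrix (Fin d) (Fin d) ℝ} (h : Stable M)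
    (hN : (1 - M) * N = 1) :
    Tendsto (fun n : ℕ => ((1 + M) * N) ^ n) atTop (𝓝 0) := by
  have key : Tendsto (fun n : ℕ => (((1 + M) * N).map Complex.ofReal) ^ n) atTop (𝓝 0) := by
    refine tendsto_pow_of_spectrum _ fun μ hμ => ?_
    obtain ⟨u, hu, hμ⟩ := (mem_spectrum_iff_exists_eigenvector _ _).1 hμ
    have hNc : (1 - M.map Complex.ofReal) * N.map Complex.ofReal = 1 := by
      have := congrArg Complex.ofRealHom.mapMatrix hN
      rwa [map_mul, map_sub, map_one] at this
    have hTc : ((1 + M) * N).map Complex.ofReal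
        = (1 + M.map Complex.ofReal) * N.map Complex.ofReal := by
      have := map_mul Complex.ofRealHom.mapMatrix (1 + M) N
      rwa [map_add, map_one] at this
    set w := N.map Complex.ofReal *ᵥ u with hw
    have hu' : u = (1 - M.map Complex.ofReal) *ᵥ w := by
      rw [hw, Matrix.mulVec_mulVec, hNc, Matrix.one_mulVec]
    have hw0 : w ≠ 0 := by
      rintro h0
      rw [h0, Matrix.mulVec_zero] at hu'
      exact hu hu'
    rw [hTc, ← Matrix.mulVec_mulVec, ← hw, hu', Matrix.add_mulVec, Matrix.sub_mulVec,
      Matrix.one_mulVec] at hμ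
    set x := M.map Complex.ofReal *ᵥ w with hx
    -- The eigenvalue equation now reads `w + x = μ (w - x)` with `x = M w`. For `μ = -1` it forces
    -- `w = 0`; otherwise `w` is an eigenvector of `M` for `(μ - 1) / (μ + 1)`, whose real part has
    -- the sign of `‖μ‖ ^ 2 - 1`.
    by_contra! hle
    by_cases hμ1 : μ + 1 = 0
    · have : μ = -1 := by linear_combination hμ1
      rw [this] at hμ
      have h2 : (2 : ℂ) • w = 0 := by
        rw [neg_one_smul] at hμ
        rw [two_smul]
        linear_combination (exp := 1) hμ
      exact hw0 ((smul_eq_zero.1 h2).resolve_left two_ne_zero)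
    · have hxw : x = ((μ - 1) / (μ + 1)) • w := by
        have h3 : (μ + 1) • x = (μ - 1) • w := by
          rw [smul_sub] at hμ
          rw [add_smul, sub_smul, one_smul, one_smul]
          linear_combination (exp := 1) hμ
        rw [div_eq_inv_mul, mul_smul, ← h3, smul_smul, inv_mul_cancel₀ hμ1, one_smul]
      have hre := h.re_neg hw0 hxw
      have hn : 0 < Complex.normSq (μ + 1) := Complex.normSq_pos.2 hμ1
      have h4 : ((μ - 1) / (μ + 1)).re = (Complex.normSq μ - 1) / Complex.normSq (μ + 1) := by
        rw [Complex.div_re, ← add_div]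
        congr 1
        simp [Complex.normSq_apply]
        ring
      rw [h4, Complex.normSq_eq_norm_sq] at hre
      have : 0 ≤ (‖μ‖ ^ 2 - 1) / Complex.normSq (μ + 1) := by
        apply div_nonneg _ hn.le
        nlinarith
      linarith
  have h2 : ∀ n : ℕ, (((1 + M) * N).map Complex.ofReal) ^ n
      = (((1 + M) * N) ^ n).map Complex.ofReal := fun n =>
    (map_pow Complex.ofRealHom.mapMatrix ((1 + M) * N) n).symm
  simp_rw [h2] at key
  have hre : Continuous fun S : Matrix (Fin d) (Fin d) ℂ => S.map Complex.re :=
    continuous_id.matrix_map Complex.continuous_re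
  simpa [Function.comp_def, Matrix.map_map, Matrix.map_zero] using (hre.tendsto 0).comp key

/-- Expanding, `(1 - M)ᵀ X (1 - M)` and `(1 + M)ᵀ X (1 + M)` differ by `-2 (Mᵀ X + X M) = 2 C`;
conjugation by `N = (1 - M)⁻¹` turns the Lyapunov equation into a Stein equation. -/
theorem lyapunov_stein {M N X C : Matrix (Fin d) (Fin d) ℝ} (hN : (1 - M) * N = 1)
    (hX : Mᵀ * X + X * M = -C) :
    X = ((1 + M) * N)ᵀ * X * ((1 + M) * N) + (2 : ℝ) • (Nᵀ * C * N) := by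
  have hNt : Nᵀ * (1 - Mᵀ) = 1 := by
    simpa using congrArg Matrix.transpose hN
  have h1 : (1 - Mᵀ) * X * (1 - M) = (1 + Mᵀ) * X * (1 + M) + (2 : ℝ) • C := by
    have hC : C = -(Mᵀ * X + X * M) := by rw [hX, neg_neg]
    rw [hC, two_smul]
    noncomm_ring
  calc X = (Nᵀ * (1 - Mᵀ)) * X * ((1 - M) * N) := by rw [hNt, hN, one_mul, mul_one]
    _ = Nᵀ * ((1 - Mᵀ) * X * (1 - M)) * N := by simp only [mul_assoc]
    _ = _ := by
      rw [h1]
      simp only [Matrix.transpose_mul, Matrix.transpose_add, Matrix.transpose_one, mul_add,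
        add_mul, mul_assoc, Matrix.mul_smul, Matrix.smul_mul]

theorem Stable.exists_cayley {M : Matrix (Fin d) (Fin d) ℝ} (h : Stable M) :
    ∃ N : Matrix (Fin d) (Fin d) ℝ, (1 - M) * N = 1 := by
  obtain ⟨u, hu⟩ := h.isUnit_one_sub
  exact ⟨↑u⁻¹, by rw [← hu]; exact u.mul_inv⟩

/-- Iterating the homogeneous Stein equation gives `X = (T ^ n)ᵀ X T ^ n`, which tends to zero. -/
theorem Stable.lyapunov_eq_zero {M X : Matrix (Fin d) (Fin d) ℝ} (h : Stable M)
    (hX : Mᵀ * X + X * M = 0) : X = 0 := by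
  obtain ⟨N, hN⟩ := h.exists_cayley
  have hT := h.tendsto_cayley_pow hN
  have hS := lyapunov_stein hN (C := 0) (by simpa using hX)
  set T := (1 + M) * N
  have hn : ∀ n : ℕ, X = (T ^ n)ᵀ * X * T ^ n := by
    intro n
    induction n with
    | zero => simp
    | succ n ih =>
      conv_lhs => rw [hS, ih]
      simp [pow_succ, mul_assoc]
  have h1 : Tendsto (fun n : ℕ => (T ^ n)ᵀ * X * T ^ n) atTop (𝓝 ((0 : Matrix _ _ ℝ)ᵀ * X * 0)) :=
    (((continuous_id.matrix_transpose.tendsto _).comp hT).mul tendsto_const_nhds).mul hT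
  rw [mul_zero] at h1
  exact tendsto_nhds_unique (tendsto_const_nhds.congr hn) h1

theorem Stable.lyapunov_unique {M X Y C : Matrix (Fin d) (Fin d) ℝ} (h : Stable M)
    (hX : Mᵀ * X + X * M = C) (hY : Mᵀ * Y + Y * M = C) : X = Y := by
  rw [← sub_eq_zero]
  apply h.lyapunov_eq_zero
  rw [mul_sub, sub_mul, sub_add_sub_comm, hX, hY, sub_self]

theorem Stable.exists_lyapunov {M : Matrix (Fin d) (Fin d) ℝ} (h : Stable M)
    (C : Matrix (Fin d) (Fin d) ℝ) : ∃ X, Mᵀ * X + X * M = C := by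
  let f : Matrix (Fin d) (Fin d) ℝ →ₗ[ℝ] Matrix (Fin d) (Fin d) ℝ :=
    LinearMap.mulLeft ℝ Mᵀ + LinearMap.mulRight ℝ M
  have hf : Function.Injective f := by
    rw [← LinearMap.ker_eq_bot, LinearMap.ker_eq_bot']
    exact fun X hX => h.lyapunov_eq_zero hX
  exact LinearMap.injective_iff_surjective.1 hf C

/-- The form `zᵀ X z` does not increase along `x, T x, T² x, …` and tends to `0`, so it starts
nonnegative. Symmetry comes from uniqueness, as `Xᵀ` solves the same equation. -/
theorem Stable.posSemidef_of_lyapunov {M X C : Matrix (Fin d) (Fin d) ℝ} (h : Stable M)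
    (hC : C.PosSemidef) (hX : Mᵀ * X + X * M = -C) : X.PosSemidef := by
  have hsym : Xᵀ = X := by
    refine h.lyapunov_unique (C := -C) ?_ hX
    have hCt : Cᵀ = C := transpose_eq_of_posSemidef hC
    have := congrArg Matrix.transpose hX
    simpa [hCt, add_comm] using this
  refine Matrix.PosSemidef.of_dotProduct_mulVec_nonneg hsym fun x => ?_
  rw [star_trivial]
  obtain ⟨N, hN⟩ := h.exists_cayley
  have hT := h.tendsto_cayley_pow hN
  have hS := lyapunov_stein hN hX
  set T := (1 + M) * N
  have hstep : ∀ z, (T *ᵥ z) ⬝ᵥ (X *ᵥ (T *ᵥ z)) ≤ z ⬝ᵥ (X *ᵥ z) := by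
    intro z
    have h1 : 0 ≤ (N *ᵥ z) ⬝ᵥ (C *ᵥ (N *ᵥ z)) := by
      simpa using hC.dotProduct_mulVec_nonneg (N *ᵥ z)
    have h2 : z ⬝ᵥ (X *ᵥ z) =
        (T *ᵥ z) ⬝ᵥ (X *ᵥ (T *ᵥ z)) + 2 * ((N *ᵥ z) ⬝ᵥ (C *ᵥ (N *ᵥ z))) := by
      conv_lhs => rw [hS]
      rw [Matrix.add_mulVec, dotProduct_add, Matrix.smul_mulVec, dotProduct_smul, smul_eq_mul,
        dotProduct_transpose_mul_mul_mulVec, dotProduct_transpose_mul_mul_mulVec]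
    linarith
  have hn : ∀ n : ℕ, (T ^ n *ᵥ x) ⬝ᵥ (X *ᵥ (T ^ n *ᵥ x)) ≤ x ⬝ᵥ (X *ᵥ x) := by
    intro n
    induction n with
    | zero => simp
    | succ n ih =>
      refine le_trans ?_ ih
      simpa [pow_succ', Matrix.mulVec_mulVec] using hstep (T ^ n *ᵥ x)
  have hc : Continuous fun S : Matrix (Fin d) (Fin d) ℝ => (S *ᵥ x) ⬝ᵥ (X *ᵥ (S *ᵥ x)) := by
    have h1 : Continuous fun S : Matrix (Fin d) (Fin d) ℝ => S *ᵥ x :=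
      continuous_id.matrix_mulVec continuous_const
    exact h1.dotProduct (continuous_const.matrix_mulVec h1)
  have hlim := (hc.tendsto 0).comp hT
  rw [Matrix.zero_mulVec, zero_dotProduct] at hlim
  exact le_of_tendsto' hlim hn

/-- A real form of `v* W v = - 2 Re z (v* P v)` for `M v = z v` and `Mᵀ P + P M = - W`. -/
theorem lyapunov_eigenvector {M P W : Matrix (Fin d) (Fin d) ℝ} (hP : Pᵀ = P)
    (hW : Mᵀ * P + P * M = -W) {α β : ℝ} {a b : Fin d → ℝ} (ha : M *ᵥ a = α • a - β • b)
    (hb : M *ᵥ b = β • a + α • b) :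
    a ⬝ᵥ (W *ᵥ a) + b ⬝ᵥ (W *ᵥ b) = -(2 * α * (a ⬝ᵥ (P *ᵥ a) + b ⬝ᵥ (P *ᵥ b))) := by
  have hW' : W = -(Mᵀ * P + P * M) := by rw [hW, neg_neg]
  have hab : b ⬝ᵥ (P *ᵥ a) = a ⬝ᵥ (P *ᵥ b) := by
    conv_lhs => rw [← hP]
    rw [Matrix.dotProduct_transpose_mulVec]
  have h1 : ∀ z, z ⬝ᵥ (W *ᵥ z) = -(2 * (z ⬝ᵥ (P *ᵥ (M *ᵥ z)))) := by
    intro z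
    have : z ⬝ᵥ (Mᵀ *ᵥ (P *ᵥ z)) = z ⬝ᵥ (P *ᵥ (M *ᵥ z)) := by
      rw [Matrix.dotProduct_transpose_mulVec]
      conv_rhs => rw [← hP]
      rw [Matrix.dotProduct_transpose_mulVec, dotProduct_comm]
    rw [hW', Matrix.neg_mulVec, Matrix.add_mulVec, dotProduct_neg, dotProduct_add,
      ← Matrix.mulVec_mulVec, ← Matrix.mulVec_mulVec, this]
    ring
  rw [h1, h1, ha, hb]
  simp only [Matrix.mulVec_sub, Matrix.mulVec_add, Matrix.mulVec_smul, dotProduct_sub,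
    dotProduct_add, dotProduct_smul, smul_eq_mul, hab]
  ring

/-- In `lyapunov_eigenvector` the left side is positive while `P` is nonnegative, which forces `α <
0`. -/
theorem stable_of_lyapunov {M P W : Matrix (Fin d) (Fin d) ℝ} (hP : P.PosSemidef)
    (hWpos : ∀ x, x ≠ 0 → 0 < x ⬝ᵥ (W *ᵥ x))
    (hW : Mᵀ * P + P * M = -W) : Stable M := by
  refine stable_iff.2 fun α β a b hab ha hb => ?_
  have h := lyapunov_eigenvector (transpose_eq_of_posSemidef hP) hW ha hb
  have hPa : 0 ≤ a ⬝ᵥ (P *ᵥ a) := by simpa using hP.dotProduct_mulVec_nonneg a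
  have hPb : 0 ≤ b ⬝ᵥ (P *ᵥ b) := by simpa using hP.dotProduct_mulVec_nonneg b
  have hnn : ∀ x, 0 ≤ x ⬝ᵥ (W *ᵥ x) := fun x => by
    by_cases hx : x = 0
    · simp [hx]
    · exact (hWpos x hx).le
  have hpos : 0 < a ⬝ᵥ (W *ᵥ a) + b ⬝ᵥ (W *ᵥ b) := by
    rcases hab with h | h
    · linarith [hWpos a h, hnn b]
    · linarith [hWpos b h, hnn a]
  by_contra! hα
  have : 0 ≤ α * (a ⬝ᵥ (P *ᵥ a) + b ⬝ᵥ (P *ᵥ b)) := by positivity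
  linarith

end SDRE

/-! ### Riccati equations and the Newton-Kleinman iteration. -/

namespace SDRE

variable {d m : ℕ}

theorem posSemidef_transpose_mul_mul {n k : Type*} [Fintype n] [Fintype k] {X : Matrix k k ℝ}
    (hX : X.PosSemidef) (S : Matrix k n ℝ) : (Sᵀ * X * S).PosSemidef := by
  rw [← Matrix.conjTranspose_eq_transpose_of_trivial]
  exact hX.conjTranspose_mul_mul_same S

theorem posSemidef_gainF (B : Matrix (Fin d) (Fin m) ℝ) {R : Matrix (Fin m) (Fin m) ℝ}
    (hR : R.PosDef) : (gainF B R).PosSemidef := by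
  simpa [gainF] using posSemidef_transpose_mul_mul hR.inv.posSemidef Bᵀ

theorem dotProduct_mulVec_nonneg {n : Type*} [Fintype n] {P : Matrix n n ℝ} (hP : P.PosSemidef)
    (x : n → ℝ) : 0 ≤ x ⬝ᵥ (P *ᵥ x) := by
  simpa using hP.dotProduct_mulVec_nonneg x

theorem mulVec_eq_zero_of_dotProduct {n : Type*} [Fintype n] {P : Matrix n n ℝ}
    (hP : P.PosSemidef) {x : n → ℝ} (h : x ⬝ᵥ (P *ᵥ x) = 0) : P *ᵥ x = 0 :=
  (hP.dotProduct_mulVec_zero_iff x).1 (by simpa using h)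

/-- Here `‖√Q x‖² = xᵀ Q x`. -/
theorem sqrt_mulVec_eq_zero {Q : Matrix (Fin d) (Fin d) ℝ} (hQ : Q.PosSemidef) {x : Fin d → ℝ}
    (h : Q *ᵥ x = 0) : (CFC.sqrt Q)ᵀ *ᵥ x = 0 := by
  have hs : (CFC.sqrt Q).PosSemidef := Matrix.nonneg_iff_posSemidef.1 (CFC.sqrt_nonneg Q)
  have ht := transpose_eq_of_posSemidef hs
  have hq : CFC.sqrt Q * CFC.sqrt Q = Q :=
    CFC.sqrt_mul_sqrt_self Q (Matrix.nonneg_iff_posSemidef.2 hQ)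
  rw [ht, ← dotProduct_self_eq_zero]
  have h1 : x ⬝ᵥ (((CFC.sqrt Q)ᵀ * CFC.sqrt Q) *ᵥ x) = 0 := by rw [ht, hq, h, dotProduct_zero]
  rwa [← Matrix.mulVec_mulVec, Matrix.dotProduct_transpose_mulVec] at h1

/-- The Hautus test: unobservable modes of a detectable pair are stable. -/
theorem Detectable.unobservable_mode {A Q : Matrix (Fin d) (Fin d) ℝ}
    (h : Detectable A (CFC.sqrt Q)) (hQ : Q.PosSemidef) {α β : ℝ} {a b : Fin d → ℝ}
    (hab : a ≠ 0 ∨ b ≠ 0) (ha : A *ᵥ a = α • a - β • b) (hb : A *ᵥ b = β • a + α • b)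
    (hQa : Q *ᵥ a = 0) (hQb : Q *ᵥ b = 0) : α < 0 := by
  obtain ⟨K, hK⟩ := h
  have hs := transpose_eq_of_posSemidef
    (Matrix.nonneg_iff_posSemidef.1 (CFC.sqrt_nonneg Q))
  -- The transposed matrix `A - Kᵀ √Q` agrees with `A` on the kernel of `Q`, so an unobservable mode
  -- is one of its modes.
  have hK' := hK.transpose
  rw [Matrix.transpose_sub, Matrix.transpose_transpose, Matrix.transpose_mul,
    Matrix.transpose_transpose] at hK'
  refine stable_iff.1 hK' α β a b hab ?_ ?_
  · rw [Matrix.sub_mulVec, ← Matrix.mulVec_mulVec, ← hs, sqrt_mulVec_eq_zero hQ hQa,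
      Matrix.mulVec_zero, sub_zero, ha]
  · rw [Matrix.sub_mulVec, ← Matrix.mulVec_mulVec, ← hs, sqrt_mulVec_eq_zero hQ hQb,
      Matrix.mulVec_zero, sub_zero, hb]

/-- On a mode with `α ≥ 0` all the forms on the right must vanish. Then `Q` and `F P` kill the mode,
so it is an unobservable mode of `A` itself, against detectability. The slack `S` is zero for a
Riccati solution and a completed square for a Kleinman iterate. -/
theorem stable_of_detectable {A F Q P S : Matrix (Fin d) (Fin d) ℝ}
    (hdet : Detectable A (CFC.sqrt Q)) (hQ : Q.PosSemidef) (hF : F.PosSemidef)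
    (hP : P.PosSemidef) (hS : S.PosSemidef)
    (h : (A - F * P)ᵀ * P + P * (A - F * P) = -(Q + P * F * P + S)) : Stable (A - F * P) := by
  have hPt := transpose_eq_of_posSemidef hP
  refine stable_iff.2 fun α β a b hab ha hb => ?_
  by_contra! hα
  have key := lyapunov_eigenvector hPt h ha hb
  have hPFP : (P * F * P).PosSemidef := by
    simpa [hPt] using posSemidef_transpose_mul_mul hF P
  have hp : 0 ≤ α * (a ⬝ᵥ (P *ᵥ a) + b ⬝ᵥ (P *ᵥ b)) :=
    mul_nonneg hα (add_nonneg (dotProduct_mulVec_nonneg hP a) (dotProduct_mulVec_nonneg hP b))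
  simp only [Matrix.add_mulVec, dotProduct_add] at key
  have q1 := dotProduct_mulVec_nonneg hQ a
  have q2 := dotProduct_mulVec_nonneg hQ b
  have f1 := dotProduct_mulVec_nonneg hPFP a
  have f2 := dotProduct_mulVec_nonneg hPFP b
  have s1 := dotProduct_mulVec_nonneg hS a
  have s2 := dotProduct_mulVec_nonneg hS b
  have hQa := mulVec_eq_zero_of_dotProduct hQ (x := a) (by linarith)
  have hQb := mulVec_eq_zero_of_dotProduct hQ (x := b) (by linarith)
  have hF0 : ∀ x, x ⬝ᵥ ((P * F * P) *ᵥ x) = 0 → (F * P) *ᵥ x = 0 := by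
    intro x hx
    rw [← Matrix.mulVec_mulVec]
    apply mulVec_eq_zero_of_dotProduct hF
    rw [← dotProduct_transpose_mul_mul_mulVec, hPt, hx]
  rw [Matrix.sub_mulVec, hF0 a (by linarith), sub_zero] at ha
  rw [Matrix.sub_mulVec, hF0 b (by linarith), sub_zero] at hb
  exact hα.not_gt (hdet.unobservable_mode hQ hab ha hb hQa hQb)

theorem IsRiccatiSol.lyapunov {A F Q P : Matrix (Fin d) (Fin d) ℝ} (hF : Fᵀ = F)
    (h : IsRiccatiSol A F Q P) :
    (A - F * P)ᵀ * P + P * (A - F * P) = -(Q + P * F * P) := by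
  have hPt := transpose_eq_of_posSemidef h.1
  have h2 : Q = -(Aᵀ * P + P * A - P * F * P) := by
    rw [eq_neg_iff_add_eq_zero, add_comm, h.2]
  rw [h2, Matrix.transpose_sub, Matrix.transpose_mul, hPt, hF]
  noncomm_ring

theorem IsRiccatiSol.stable {A F Q P : Matrix (Fin d) (Fin d) ℝ} (h : IsRiccatiSol A F Q P)
    (hdet : Detectable A (CFC.sqrt Q)) (hQ : Q.PosSemidef) (hF : F.PosSemidef) :
    Stable (A - F * P) :=
  stable_of_detectable hdet hQ hF h.1 Matrix.PosSemidef.zero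
    (by rw [h.lyapunov (transpose_eq_of_posSemidef hF), add_zero])

/-- With `D = P - P'` and `M = A - F P`, subtracting the two Riccati equations gives `Mᵀ D + D M =
-D F D`: a stabilizing solution dominates every other. -/
theorem IsRiccatiSol.sub_posSemidef {A F Q P P' : Matrix (Fin d) (Fin d) ℝ}
    (h : IsRiccatiSol A F Q P) (h' : IsRiccatiSol A F Q P') (hF : F.PosSemidef)
    (hs : Stable (A - F * P)) : (P - P').PosSemidef := by
  have hPt := transpose_eq_of_posSemidef h.1
  have hPt' := transpose_eq_of_posSemidef h'.1
  have hFt := transpose_eq_of_posSemidef hF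
  have hC : ((P - P') * F * (P - P')).PosSemidef := by
    simpa [hPt, hPt'] using posSemidef_transpose_mul_mul hF (P - P')
  refine hs.posSemidef_of_lyapunov hC ?_
  rw [Matrix.transpose_sub, Matrix.transpose_mul, hPt, hFt, ← sub_eq_zero]
  have e : (Aᵀ * P + P * A - P * F * P + Q) - (Aᵀ * P' + P' * A - P' * F * P' + Q) = 0 := by
    rw [h.2, h'.2, sub_zero]
  rw [← e]
  noncomm_ring

theorem IsRiccatiSol.unique {A F Q P P' : Matrix (Fin d) (Fin d) ℝ}
    (h : IsRiccatiSol A F Q P) (h' : IsRiccatiSol A F Q P')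
    (hdet : Detectable A (CFC.sqrt Q)) (hQ : Q.PosSemidef) (hF : F.PosSemidef) : P = P' :=
  le_antisymm (Matrix.le_iff.2 (h'.sub_posSemidef h hF (h'.stable hdet hQ hF)))
    (Matrix.le_iff.2 (h.sub_posSemidef h' hF (h.stable hdet hQ hF)))

/-- Each quadratic form is a decreasing sequence bounded below by `0`; polarization recovers the
matrix entries. -/
theorem exists_tendsto_of_antitone_posSemidef {X : ℕ → Matrix (Fin d) (Fin d) ℝ}
    (hX : ∀ k, (X k).PosSemidef) (hanti : ∀ k, (X k - X (k + 1)).PosSemidef) :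
    ∃ P : Matrix (Fin d) (Fin d) ℝ, P.PosSemidef ∧ Tendsto X atTop (𝓝 P) := by
  have hq : ∀ x : Fin d → ℝ, ∃ l, Tendsto (fun k => x ⬝ᵥ (X k *ᵥ x)) atTop (𝓝 l) := by
    intro x
    refine ⟨_, tendsto_atTop_ciInf (antitone_nat_of_succ_le fun k => ?_) ⟨0, ?_⟩⟩
    · have := dotProduct_mulVec_nonneg (hanti k) x
      rwa [Matrix.sub_mulVec, dotProduct_sub, sub_nonneg] at this
    · rintro _ ⟨k, rfl⟩
      exact dotProduct_mulVec_nonneg (hX k) x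
  choose l hl using hq
  let e : Fin d → Fin d → ℝ := fun i => Pi.single i 1
  have hent : ∀ k i j, X k i j =
      ((e i + e j) ⬝ᵥ (X k *ᵥ (e i + e j)) - (e i - e j) ⬝ᵥ (X k *ᵥ (e i - e j))) / 4 := by
    intro k i j
    have hs : X k j i = X k i j := congrFun (congrFun (transpose_eq_of_posSemidef (hX k)) i) j
    simp [e, Matrix.mulVec_add, Matrix.mulVec_sub, hs]
    ring
  let P : Matrix (Fin d) (Fin d) ℝ := Matrix.of fun i j => (l (e i + e j) - l (e i - e j)) / 4
  have hlim : Tendsto X atTop (𝓝 P) := by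
    refine tendsto_pi_nhds.2 fun i => tendsto_pi_nhds.2 fun j => ?_
    simp_rw [hent]
    exact ((hl _).sub (hl _)).div_const 4
  refine ⟨P, Matrix.PosSemidef.of_dotProduct_mulVec_nonneg ?_ fun x => ?_, hlim⟩
  · have h1 : Tendsto (fun k => (X k)ᵀ) atTop (𝓝 Pᵀ) :=
      (continuous_id.matrix_transpose.tendsto _).comp hlim
    exact tendsto_nhds_unique (h1.congr fun k => transpose_eq_of_posSemidef (hX k)) hlim
  · have hc : Continuous fun S : Matrix (Fin d) (Fin d) ℝ => star x ⬝ᵥ (S *ᵥ x) :=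
      continuous_const.dotProduct (continuous_id.matrix_mulVec continuous_const)
    exact ge_of_tendsto' ((hc.tendsto P).comp hlim)
      fun k => by simpa using dotProduct_mulVec_nonneg (hX k) x

/-- One Newton-Kleinman step from a stabilizing feedback `K`. -/
theorem kleinman_step {A Q P : Matrix (Fin d) (Fin d) ℝ} {B : Matrix (Fin d) (Fin m) ℝ}
    {R : Matrix (Fin m) (Fin m) ℝ} {K : Matrix (Fin m) (Fin d) ℝ} (hQ : Q.PosSemidef)
    (hR : R.PosDef) (hs : Stable (A - B * K))
    (hP : (A - B * K)ᵀ * P + P * (A - B * K) = -(Kᵀ * R * K) - Q) :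
    P.PosSemidef ∧ ∃ S : Matrix (Fin d) (Fin d) ℝ, S.PosSemidef ∧
      (A - gainF B R * P)ᵀ * P + P * (A - gainF B R * P) =
        -(Q + P * gainF B R * P + S) := by
  have hPp : P.PosSemidef := hs.posSemidef_of_lyapunov
    ((posSemidef_transpose_mul_mul hR.posSemidef K).add hQ) (by rw [hP, neg_add, sub_eq_add_neg])
  -- The defect is the completed square measuring the distance of `K` from the improved feedback
  -- `R⁻¹ Bᵀ P`.
  refine ⟨hPp, _, posSemidef_transpose_mul_mul hR.posSemidef (K - R⁻¹ * Bᵀ * P), ?_⟩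
  have hPt := transpose_eq_of_posSemidef hPp
  have hRt := transpose_eq_of_posSemidef hR.posSemidef
  have hFt := transpose_eq_of_posSemidef (posSemidef_gainF B hR)
  have hdet : IsUnit R.det := (Matrix.isUnit_iff_isUnit_det R).1 hR.isUnit
  have e1 : Kᵀ * R * (R⁻¹ * Bᵀ * P) = Kᵀ * Bᵀ * P := by
    simp only [Matrix.mul_assoc, Matrix.mul_nonsing_inv_cancel_left _ _ hdet]
  have e2 : (R⁻¹ * Bᵀ * P)ᵀ * R * K = P * B * K := by
    simp only [Matrix.transpose_mul, Matrix.transpose_transpose, Matrix.transpose_nonsing_inv, hPt,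
      hRt, Matrix.mul_assoc, Matrix.nonsing_inv_mul_cancel_left _ _ hdet]
  have e3 : (R⁻¹ * Bᵀ * P)ᵀ * R * (R⁻¹ * Bᵀ * P) = P * gainF B R * P := by
    simp only [Matrix.transpose_mul, Matrix.transpose_transpose, Matrix.transpose_nonsing_inv, hPt,
      hRt, gainF, Matrix.mul_assoc, Matrix.nonsing_inv_mul_cancel_left _ _ hdet]
  have e4 : (K - R⁻¹ * Bᵀ * P)ᵀ * R * (K - R⁻¹ * Bᵀ * P) =
      Kᵀ * R * K - Kᵀ * Bᵀ * P - P * B * K + P * gainF B R * P := by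
    rw [← e1, ← e2, ← e3, Matrix.transpose_sub]
    simp only [Matrix.sub_mul, Matrix.mul_sub]
    abel
  rw [e4]
  have hQ' : Q = -(Kᵀ * R * K) - ((A - B * K)ᵀ * P + P * (A - B * K)) := by rw [hP]; abel
  rw [hQ']
  simp only [Matrix.transpose_sub, Matrix.transpose_mul, hPt, hFt, Matrix.sub_mul, Matrix.mul_sub,
    Matrix.mul_assoc]
  abel

/-- The feedback is `K = R⁻¹ Bᵀ P₀`, for which `B K = F P₀` and `Kᵀ R K = P₀ F P₀`. -/
theorem kleinman_step_of_symm {A Q P₀ P : Matrix (Fin d) (Fin d) ℝ}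
    {B : Matrix (Fin d) (Fin m) ℝ} {R : Matrix (Fin m) (Fin m) ℝ} (hQ : Q.PosSemidef)
    (hR : R.PosDef) (hP₀ : P₀ᵀ = P₀) (hs : Stable (A - gainF B R * P₀))
    (hP : (A - gainF B R * P₀)ᵀ * P + P * (A - gainF B R * P₀) =
      -(P₀ * gainF B R * P₀) - Q) :
    P.PosSemidef ∧ ∃ S : Matrix (Fin d) (Fin d) ℝ, S.PosSemidef ∧
      (A - gainF B R * P)ᵀ * P + P * (A - gainF B R * P) =
        -(Q + P * gainF B R * P + S) := by
  have hRt := transpose_eq_of_posSemidef hR.posSemidef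
  have hdet : IsUnit R.det := (Matrix.isUnit_iff_isUnit_det R).1 hR.isUnit
  have e1 : B * (R⁻¹ * Bᵀ * P₀) = gainF B R * P₀ := by simp only [gainF, Matrix.mul_assoc]
  have e2 : (R⁻¹ * Bᵀ * P₀)ᵀ * R * (R⁻¹ * Bᵀ * P₀) = P₀ * gainF B R * P₀ := by
    simp only [Matrix.transpose_mul, Matrix.transpose_transpose, Matrix.transpose_nonsing_inv, hP₀,
      hRt, gainF, Matrix.mul_assoc, Matrix.nonsing_inv_mul_cancel_left _ _ hdet]
  exact kleinman_step (K := R⁻¹ * Bᵀ * P₀) hQ hR (by rwa [e1]) (by rwa [e1, e2])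

theorem IsNewtonKleinman.invariant {A Q P₀ : Matrix (Fin d) (Fin d) ℝ}
    {B : Matrix (Fin d) (Fin m) ℝ} {R : Matrix (Fin m) (Fin m) ℝ}
    {X : ℕ → Matrix (Fin d) (Fin d) ℝ} (hX : IsNewtonKleinman A (gainF B R) Q P₀ X)
    (hdet : Detectable A (CFC.sqrt Q)) (hQ : Q.PosSemidef)
    (hR : R.PosDef) (hP₀ : P₀ᵀ = P₀) (hs : Stable (A - gainF B R * P₀)) (k : ℕ) :
    (X k)ᵀ = X k ∧ Stable (A - gainF B R * X k) := by
  induction k with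
  | zero => rw [hX.1]; exact ⟨hP₀, hs⟩
  | succ k ih =>
    obtain ⟨h1, S, hS, h2⟩ := kleinman_step_of_symm hQ hR ih.1 ih.2 (hX.2 k)
    exact ⟨transpose_eq_of_posSemidef h1,
      stable_of_detectable hdet hQ (posSemidef_gainF B hR) h1 hS h2⟩

theorem IsNewtonKleinman.exists_tendsto {A Q P₀ : Matrix (Fin d) (Fin d) ℝ}
    {B : Matrix (Fin d) (Fin m) ℝ} {R : Matrix (Fin m) (Fin m) ℝ}
    {X : ℕ → Matrix (Fin d) (Fin d) ℝ} (hX : IsNewtonKleinman A (gainF B R) Q P₀ X)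
    (hdet : Detectable A (CFC.sqrt Q)) (hQ : Q.PosSemidef)
    (hR : R.PosDef) (hP₀ : P₀ᵀ = P₀) (hs : Stable (A - gainF B R * P₀)) :
    ∃ P, IsRiccatiSol A (gainF B R) Q P ∧ Tendsto X atTop (𝓝 P) := by
  have hinv := hX.invariant hdet hQ hR hP₀ hs
  have hstep := fun k => kleinman_step_of_symm hQ hR (hinv k).1 (hinv k).2 (hX.2 k)
  -- The shift matters: the start `P₀` need not dominate the first iterate. From index 1 on,
  -- consecutive differences solve a Lyapunov equation with right side `-S`.
  have hanti : ∀ k, (X (k + 1) - X (k + 1 + 1)).PosSemidef := by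
    intro k
    obtain ⟨-, S, hS, h1⟩ := hstep k
    refine (hinv (k + 1)).2.posSemidef_of_lyapunov hS ?_
    rw [Matrix.mul_sub, Matrix.sub_mul, sub_add_sub_comm, h1, hX.2 (k + 1)]
    abel
  obtain ⟨P, hP, hlim⟩ := exists_tendsto_of_antitone_posSemidef (X := fun k => X (k + 1))
    (fun k => (hstep k).1) hanti
  have hlim0 : Tendsto X atTop (𝓝 P) := (tendsto_add_atTop_iff_nat 1).1 hlim
  refine ⟨P, ⟨hP, ?_⟩, hlim0⟩
  have hM : Tendsto (fun k => A - gainF B R * X k) atTop (𝓝 (A - gainF B R * P)) :=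
    tendsto_const_nhds.sub (tendsto_const_nhds.mul hlim0)
  have hMt : Tendsto (fun k => (A - gainF B R * X k)ᵀ) atTop (𝓝 (A - gainF B R * P)ᵀ) :=
    (continuous_id.matrix_transpose.tendsto _).comp hM
  have hr : Tendsto (fun k => -(X k * gainF B R * X k) - Q) atTop
      (𝓝 (-(P * gainF B R * P) - Q)) :=
    ((hlim0.mul tendsto_const_nhds).mul hlim0).neg.sub_const Q
  have e := tendsto_nhds_unique (((hMt.mul hlim).add (hlim.mul hM)).congr hX.2) hr
  rw [Matrix.transpose_sub, Matrix.transpose_mul, transpose_eq_of_posSemidef hP,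
    transpose_eq_of_posSemidef (posSemidef_gainF B hR), ← sub_eq_zero] at e
  rw [← e]
  noncomm_ring

theorem existsUnique_isNewtonKleinman {A Q P₀ : Matrix (Fin d) (Fin d) ℝ}
    {B : Matrix (Fin d) (Fin m) ℝ} {R : Matrix (Fin m) (Fin m) ℝ}
    (hdet : Detectable A (CFC.sqrt Q)) (hQ : Q.PosSemidef)
    (hR : R.PosDef) (hP₀ : P₀ᵀ = P₀) (hs : Stable (A - gainF B R * P₀)) :
    ∃! X, IsNewtonKleinman A (gainF B R) Q P₀ X := by
  let next : Matrix (Fin d) (Fin d) ℝ → Matrix (Fin d) (Fin d) ℝ := fun P =>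
    Classical.epsilon fun P' => (A - gainF B R * P)ᵀ * P' + P' * (A - gainF B R * P) =
      -(P * gainF B R * P) - Q
  let X : ℕ → Matrix (Fin d) (Fin d) ℝ := fun k => next^[k] P₀
  have hnext : ∀ k, Stable (A - gainF B R * X k) →
      (A - gainF B R * X k)ᵀ * X (k + 1) + X (k + 1) * (A - gainF B R * X k) =
        -(X k * gainF B R * X k) - Q := by
    intro k hk
    simp only [X, Function.iterate_succ_apply']
    exact Classical.epsilon_spec (hk.exists_lyapunov _)
  have hinv : ∀ k, (X k)ᵀ = X k ∧ Stable (A - gainF B R * X k) := by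
    intro k
    induction k with
    | zero => exact ⟨hP₀, hs⟩
    | succ k ih =>
      obtain ⟨h1, S, hS, h2⟩ := kleinman_step_of_symm hQ hR ih.1 ih.2 (hnext k ih.2)
      exact ⟨transpose_eq_of_posSemidef h1,
        stable_of_detectable hdet hQ (posSemidef_gainF B hR) h1 hS h2⟩
  refine ⟨X, ⟨rfl, fun k => hnext k (hinv k).2⟩, fun Y hY => funext fun k => ?_⟩
  induction k with
  | zero => exact hY.1
  | succ k ih =>
    have h1 := hY.2 k
    rw [ih] at h1
    exact (hinv k).2.lyapunov_unique h1 (hnext k (hinv k).2)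

/-- One step from a stabilizing feedback `K`, which need not come from a symmetric matrix, yields a
symmetric stabilizing start; the limit of the iteration from there is a solution. -/
theorem existsUnique_isRiccatiSol {A Q : Matrix (Fin d) (Fin d) ℝ}
    {B : Matrix (Fin d) (Fin m) ℝ} {R : Matrix (Fin m) (Fin m) ℝ} (hstab : Stabilizable A B)
    (hdet : Detectable A (CFC.sqrt Q)) (hQ : Q.PosSemidef) (hR : R.PosDef) :
    ∃! P, IsRiccatiSol A (gainF B R) Q P := by
  obtain ⟨K, hK⟩ := hstab
  obtain ⟨P₁, hP₁⟩ := hK.exists_lyapunov (-(Kᵀ * R * K) - Q)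
  obtain ⟨h1, S, hS, h2⟩ := kleinman_step hQ hR hK hP₁
  have hF := posSemidef_gainF B hR
  have hs := stable_of_detectable hdet hQ hF h1 hS h2
  have ht := transpose_eq_of_posSemidef h1
  obtain ⟨X, hX, -⟩ := existsUnique_isNewtonKleinman hdet hQ hR ht hs
  obtain ⟨P, hP, -⟩ := hX.exists_tendsto hdet hQ hR ht hs
  exact ⟨P, hP, fun P' hP' => hP'.unique hP hdet hQ hF⟩

theorem isRiccatiSol_riccatiSol {A F Q : Matrix (Fin d) (Fin d) ℝ}
    (h : ∃! P, IsRiccatiSol A F Q P) : IsRiccatiSol A F Q (riccatiSol A F Q) :=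
  Classical.epsilon_spec h.exists

end SDRE

/-! ### Perturbation of stable matrices, logarithmic norms and the speed of trajectories. -/

namespace SDRE

variable {d : ℕ}

theorem act_eq_toEuclideanCLM (M : Matrix (Fin d) (Fin d) ℝ) (x : EuclideanSpace ℝ (Fin d)) :
    act M x = Matrix.toEuclideanCLM (𝕜 := ℝ) M x := by
  apply (WithLp.equiv 2 _).injective
  exact (Matrix.ofLp_toEuclideanCLM M x).symm

theorem norm_act_le (M : Matrix (Fin d) (Fin d) ℝ) (x : EuclideanSpace ℝ (Fin d)) :
    ‖act M x‖ ≤ ‖M‖ * ‖x‖ := by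
  rw [act_eq_toEuclideanCLM, ← Matrix.l2_opNorm_toEuclideanCLM]
  exact ContinuousLinearMap.le_opNorm _ _

/-- The old Lyapunov matrix `H` still works: the right side becomes `-(1 - (Eᵀ H + H E))`, and the
form of `Eᵀ H + H E` is at most `2 ‖E‖ ‖H‖ ‖x‖²`. -/
theorem stable_add_of_norm_lt {M E : Matrix (Fin d) (Fin d) ℝ} (hM : Stable M)
    (hE : 2 * ‖E‖ * ‖lyapunovSol M‖ < 1) : Stable (M + E) := by
  have hH : Mᵀ * lyapunovSol M + lyapunovSol M * M = -1 :=
    Classical.epsilon_spec (hM.exists_lyapunov (-1))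
  set H := lyapunovSol M
  have hHp : H.PosSemidef := hM.posSemidef_of_lyapunov Matrix.PosSemidef.one hH
  have hHt := transpose_eq_of_posSemidef hHp
  refine stable_of_lyapunov (W := 1 - (Eᵀ * H + H * E)) hHp (fun x hx => ?_) ?_
  · let u : EuclideanSpace ℝ (Fin d) := WithLp.toLp 2 x
    have hu : 0 < ‖u‖ ^ 2 := by
      have : u ≠ 0 := fun h => hx (congrArg WithLp.ofLp h)
      positivity
    have h1 : x ⬝ᵥ x = ‖u‖ ^ 2 := by
      rw [← real_inner_self_eq_norm_sq]
      exact (EuclideanSpace.inner_eq_star_dotProduct u u).symm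
    have h2 : x ⬝ᵥ (H *ᵥ (E *ᵥ x)) = inner ℝ u (act H (act E u)) := by
      rw [EuclideanSpace.inner_eq_star_dotProduct, star_trivial, dotProduct_comm]
      rfl
    have h3 : inner ℝ u (act H (act E u)) ≤ ‖H‖ * ‖E‖ * ‖u‖ ^ 2 :=
      calc inner ℝ u (act H (act E u)) ≤ ‖u‖ * ‖act H (act E u)‖ := real_inner_le_norm _ _
        _ ≤ ‖u‖ * (‖H‖ * (‖E‖ * ‖u‖)) := by
          gcongr
          exact (norm_act_le _ _).trans (by gcongr; exact norm_act_le _ _)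
        _ = _ := by ring
    have h4 : x ⬝ᵥ (Eᵀ *ᵥ (H *ᵥ x)) = x ⬝ᵥ (H *ᵥ (E *ᵥ x)) := by
      rw [Matrix.dotProduct_transpose_mulVec]
      conv_rhs => rw [← hHt]
      rw [Matrix.dotProduct_transpose_mulVec, dotProduct_comm]
    rw [Matrix.sub_mulVec, Matrix.add_mulVec, Matrix.one_mulVec, ← Matrix.mulVec_mulVec,
      ← Matrix.mulVec_mulVec, dotProduct_sub, dotProduct_add, h4, h2, h1]
    nlinarith
  · have : (M + E)ᵀ * H + H * (M + E) = (Mᵀ * H + H * M) + (Eᵀ * H + H * E) := by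
      rw [Matrix.transpose_add]
      noncomm_ring
    rw [this, hH]
    abel

theorem inner_act_le_logm (M : Matrix (Fin d) (Fin d) ℝ) (x : EuclideanSpace ℝ (Fin d)) :
    inner ℝ x (act M x) ≤ logm (M.map Complex.ofReal) * ‖x‖ ^ 2 := by
  by_cases hx : x = 0
  · simp [hx]
  set N := M.map Complex.ofReal
  -- Boundedness is essential: a real supremum over an unbounded set takes the default value `0`.
  have hbdd : BddAbove (Set.range fun z : {z : EuclideanSpace ℂ (Fin d) // z ≠ 0} =>
      (star z.1.ofLp ⬝ᵥ (N *ᵥ z.1.ofLp)).re / ‖z.1‖ ^ 2) := by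
    refine ⟨‖N‖, ?_⟩
    rintro _ ⟨⟨z, hz⟩, rfl⟩
    have hz' : 0 < ‖z‖ ^ 2 := by positivity
    rw [div_le_iff₀ hz']
    have h1 : star z.ofLp ⬝ᵥ (N *ᵥ z.ofLp) = inner ℂ z (Matrix.toEuclideanCLM (𝕜 := ℂ) N z) := by
      rw [EuclideanSpace.inner_eq_star_dotProduct, Matrix.ofLp_toEuclideanCLM, dotProduct_comm]
    rw [h1]
    calc _ ≤ ‖inner ℂ z (Matrix.toEuclideanCLM (𝕜 := ℂ) N z)‖ := Complex.re_le_norm _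
      _ ≤ ‖z‖ * ‖Matrix.toEuclideanCLM (𝕜 := ℂ) N z‖ := norm_inner_le_norm _ _
      _ ≤ ‖z‖ * (‖N‖ * ‖z‖) := by
        gcongr
        rw [← Matrix.l2_opNorm_toEuclideanCLM N]
        exact ContinuousLinearMap.le_opNorm _ _
      _ = _ := by ring
  let z : EuclideanSpace ℂ (Fin d) := WithLp.toLp 2 fun i => (x i : ℂ)
  have hzn : ‖z‖ = ‖x‖ := by simp [z, EuclideanSpace.norm_eq]
  have hz : z ≠ 0 := by rwa [← norm_ne_zero_iff, hzn, norm_ne_zero_iff]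
  have h2 : (star z.ofLp ⬝ᵥ (N *ᵥ z.ofLp)).re = inner ℝ x (act M x) := by
    simp [z, N, EuclideanSpace.inner_eq_star_dotProduct, act, Matrix.mulVec, dotProduct,
      mul_comm]
  have h3 := le_ciSup hbdd ⟨z, hz⟩
  rw [h2, hzn] at h3
  have hx' : 0 < ‖x‖ ^ 2 := by positivity
  rwa [div_le_iff₀ hx'] at h3

theorem act_add_left (M N : Matrix (Fin d) (Fin d) ℝ) (x : EuclideanSpace ℝ (Fin d)) :
    act (M + N) x = act M x + act N x := by
  simp [act_eq_toEuclideanCLM]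

/-- This rewrites the product-rule term, where the direction enters through the derivative, as one
matrix applied to that direction. -/
theorem act_fderiv_eq_act_gradMul (G : EuclideanSpace ℝ (Fin d) → Matrix (Fin d) (Fin d) ℝ)
    (x h : EuclideanSpace ℝ (Fin d)) : act (fderiv ℝ G x h) x = act (gradMul G x) h := by
  have hh : h = ∑ j, h j • EuclideanSpace.single j (1 : ℝ) := by
    ext i
    simp [Finset.sum_apply, Pi.single_apply]
  have h1 : fderiv ℝ G x h = ∑ j, h j • fderiv ℝ G x (EuclideanSpace.single j 1) := by
    conv_lhs => rw [hh]
    rw [map_sum]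
    simp_rw [map_smul]
  ext i
  rw [h1]
  simp only [act, gradMul, Matrix.sum_mulVec, Matrix.smul_mulVec, Finset.sum_apply, Pi.smul_apply,
    smul_eq_mul]
  simp only [Matrix.mulVec, dotProduct, Matrix.of_apply]
  exact Finset.sum_congr rfl fun j _ => mul_comm _ _

theorem hasFDerivAt_act_self {G : EuclideanSpace ℝ (Fin d) → Matrix (Fin d) (Fin d) ℝ}
    {x : EuclideanSpace ℝ (Fin d)} (hG : DifferentiableAt ℝ G x) :
    HasFDerivAt (fun z => act (G z) z)
      (Matrix.toEuclideanCLM (𝕜 := ℝ) (G x + gradMul G x)) x := by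
  let L : Matrix (Fin d) (Fin d) ℝ →L[ℝ]
      (EuclideanSpace ℝ (Fin d) →L[ℝ] EuclideanSpace ℝ (Fin d)) :=
    LinearMap.toContinuousLinearMap
      (Matrix.toEuclideanCLM (𝕜 := ℝ) (n := Fin d)).toAlgEquiv.toLinearMap
  have h := (L.hasFDerivAt.comp x hG.hasFDerivAt).clm_apply (hasFDerivAt_id x)
  have hf : (fun z => act (G z) z) = fun z => (L ∘ G) z (id z) :=
    funext fun z => act_eq_toEuclideanCLM _ _
  rw [hf]
  refine h.congr_fderiv ?_
  ext1 z
  have e := act_fderiv_eq_act_gradMul G x z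
  rw [act_eq_toEuclideanCLM, act_eq_toEuclideanCLM] at e
  change Matrix.toEuclideanCLM (𝕜 := ℝ) (G x) z +
    Matrix.toEuclideanCLM (𝕜 := ℝ) (fderiv ℝ G x z) x = _
  rw [e, map_add]
  rfl

/-- The speed of a trajectory of `y' = G(y) y` does not increase when the symmetric part of the
Jacobian of the vector field is negative semidefinite. -/
theorem norm_velocity_le {G : EuclideanSpace ℝ (Fin d) → Matrix (Fin d) (Fin d) ℝ}
    {y : ℝ → EuclideanSpace ℝ (Fin d)} {T : ℝ}
    (hG : ∀ s ∈ Set.Icc 0 T, DifferentiableAt ℝ G (y s))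
    (hlog : ∀ s ∈ Set.Icc 0 T, logm ((G (y s)).map Complex.ofReal) +
      logm ((gradMul G (y s)).map Complex.ofReal) ≤ 0)
    (hy : ∀ s ∈ Set.Icc 0 T, HasDerivWithinAt y (act (G (y s)) (y s)) (Set.Icc 0 T) s)
    {s : ℝ} (hs : s ∈ Set.Icc 0 T) : ‖act (G (y s)) (y s)‖ ≤ ‖act (G (y 0)) (y 0)‖ := by
  set v : ℝ → EuclideanSpace ℝ (Fin d) := fun s => act (G (y s)) (y s) with hv
  have hv' : ∀ s ∈ Set.Icc 0 T, HasDerivWithinAt v (act (G (y s) + gradMul G (y s)) (v s))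
      (Set.Icc 0 T) s := by
    intro s hs
    rw [act_eq_toEuclideanCLM]
    exact (hasFDerivAt_act_self (hG s hs)).comp_hasDerivWithinAt s (hy s hs)
  have hn : ∀ s ∈ Set.Icc 0 T, HasDerivWithinAt (fun s => ‖v s‖ ^ 2)
      (2 * inner ℝ (v s) (act (G (y s) + gradMul G (y s)) (v s))) (Set.Icc 0 T) s :=
    fun s hs => (hv' s hs).norm_sq
  have hanti : AntitoneOn (fun s => ‖v s‖ ^ 2) (Set.Icc 0 T) := by
    have hd : ∀ s ∈ interior (Set.Icc 0 T), HasDerivAt (fun s => ‖v s‖ ^ 2)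
        (2 * inner ℝ (v s) (act (G (y s) + gradMul G (y s)) (v s))) s := fun s hs =>
      (hn s (interior_subset hs)).hasDerivAt (mem_interior_iff_mem_nhds.1 hs)
    refine antitoneOn_of_deriv_nonpos (convex_Icc 0 T)
      (fun s hs => (hn s hs).continuousWithinAt)
      (fun s hs => (hd s hs).differentiableAt.differentiableWithinAt) fun s hs => ?_
    -- The derivative of `‖v‖²` is `2 ⟪v, J v⟫`, at most twice the sum of the two logarithmic norms
    -- times `‖v‖²`.
    rw [(hd s hs).deriv, act_add_left, inner_add_right]
    have h1 := inner_act_le_logm (G (y s)) (v s)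
    have h2 := inner_act_le_logm (gradMul G (y s)) (v s)
    have h3 := mul_nonpos_of_nonpos_of_nonneg (hlog s (interior_subset hs)) (sq_nonneg ‖v s‖)
    rw [add_mul] at h3
    linarith
  have := hanti (Set.left_mem_Icc.2 (hs.1.trans hs.2)) hs hs.1
  exact (sq_le_sq₀ (norm_nonneg _) (norm_nonneg _)).1 this

end SDRE

/-! ### The proposition on the SDRE update. -/

theorem proposition3p2 {d m : ℕ}
    (Ω : Set (EuclideanSpace ℝ (Fin d))) (hΩ : IsOpen Ω)
    (A : EuclideanSpace ℝ (Fin d) → Matrix (Fin d) (Fin d) ℝ)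
    (B : Matrix (Fin d) (Fin m) ℝ)
    (Q : Matrix (Fin d) (Fin d) ℝ) (hQ : Q.PosSemidef)
    (R : Matrix (Fin m) (Fin m) ℝ) (hR : R.PosDef)
    (F : Matrix (Fin d) (Fin d) ℝ) (hF : F = SDRE.gainF B R)
    (Acl : EuclideanSpace ℝ (Fin d) → Matrix (Fin d) (Fin d) ℝ)
    (hAcl : Acl = SDRE.closedLoop A F Q)
    -- stabilizability and detectability
    (hstab : ∀ x ∈ Ω, SDRE.Stabilizable (A x) B)
    (hdet : ∀ x ∈ Ω, SDRE.Detectable (A x) (CFC.sqrt Q))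
    -- Lipschitz continuity of `A`
    (LA : ℝ) (hLA : 0 < LA)
    (hLip : ∀ x ∈ Ω, ∀ x' ∈ Ω, ‖A x - A x'‖ ≤ LA * ‖x - x'‖)
    -- the condition on the logarithmic norms
    (hdiff : ∀ x ∈ Ω, DifferentiableAt ℝ Acl x)
    (hlog : ∀ x ∈ Ω, SDRE.logm ((Acl x).map Complex.ofReal) +
      SDRE.logm ((SDRE.gradMul Acl x).map Complex.ofReal) < 0)
    -- the controlled trajectory in `Ω`
    (t Δt : ℝ) (ht : 0 ≤ t) (hΔt : 0 ≤ Δt)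
    (y : ℝ → EuclideanSpace ℝ (Fin d))
    (hyΩ : ∀ s ∈ Set.Icc 0 (t + Δt), y s ∈ Ω)
    (hy : ∀ s ∈ Set.Icc 0 (t + Δt),
      HasDerivWithinAt y (SDRE.act (Acl (y s)) (y s)) (Set.Icc 0 (t + Δt)) s)
    -- the step size condition, cleared of its denominator
    (hstep : Δt * (2 * LA * ‖SDRE.act (Acl (y 0)) (y 0)‖ * ‖SDRE.lyapunovSol (Acl (y t))‖) < 1) :
    SDRE.Stable (A (y (t + Δt)) - F * SDRE.riccatiSol (A (y t)) F Q) ∧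
    (∃! P, SDRE.IsRiccatiSol (A (y (t + Δt))) F Q P) ∧
    (∃! X, SDRE.IsNewtonKleinman (A (y (t + Δt))) F Q (SDRE.riccatiSol (A (y t)) F Q) X) ∧
    (∀ X, SDRE.IsNewtonKleinman (A (y (t + Δt))) F Q (SDRE.riccatiSol (A (y t)) F Q) X →
      Tendsto X atTop (𝓝 (SDRE.riccatiSol (A (y (t + Δt))) F Q))) := by
  subst hF hAcl
  have h0 : (0 : ℝ) ≤ t + Δt := by positivity
  have hmt : t ∈ Set.Icc 0 (t + Δt) := ⟨ht, by linarith⟩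
  have hmT : t + Δt ∈ Set.Icc 0 (t + Δt) := ⟨h0, le_rfl⟩
  have hFp := SDRE.posSemidef_gainF B hR
  have hP := fun x hx =>
    SDRE.existsUnique_isRiccatiSol (hstab x hx) (hdet x hx) hQ hR
  have hPt := SDRE.isRiccatiSol_riccatiSol (hP _ (hyΩ t hmt))
  have hPT := SDRE.isRiccatiSol_riccatiSol (hP _ (hyΩ _ hmT))
  have hstable : SDRE.Stable (SDRE.closedLoop A (SDRE.gainF B R) Q (y t)) :=
    hPt.stable (hdet _ (hyΩ t hmt)) hQ hFp
  -- Mean value inequality, with the initial speed as a bound on the whole interval.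
  have hmove : ‖y (t + Δt) - y t‖ ≤
      ‖SDRE.act (SDRE.closedLoop A (SDRE.gainF B R) Q (y 0)) (y 0)‖ * Δt := by
    have := (convex_Icc 0 (t + Δt)).norm_image_sub_le_of_norm_hasDerivWithin_le hy
      (fun s hs => SDRE.norm_velocity_le (fun s hs => hdiff _ (hyΩ s hs))
        (fun s hs => (hlog _ (hyΩ s hs)).le) hy hs) hmt hmT
    rwa [add_sub_cancel_left, Real.norm_of_nonneg hΔt] at this
  have hA : ‖A (y (t + Δt)) - A (y t)‖ ≤
      LA * (‖SDRE.act (SDRE.closedLoop A (SDRE.gainF B R) Q (y 0)) (y 0)‖ * Δt) :=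
    (hLip _ (hyΩ _ hmT) _ (hyΩ t hmt)).trans (by gcongr)
  have hs : SDRE.Stable (A (y (t + Δt)) -
      SDRE.gainF B R * SDRE.riccatiSol (A (y t)) (SDRE.gainF B R) Q) := by
    -- Since the gain stays frozen at `y t`, the closed-loop matrix changes only by the change of
    -- `A`.
    have h1 := SDRE.stable_add_of_norm_lt (E := A (y (t + Δt)) - A (y t)) hstable <| by
      refine lt_of_le_of_lt ?_ hstep
      calc _ ≤ 2 * (LA * (‖SDRE.act (SDRE.closedLoop A (SDRE.gainF B R) Q (y 0)) (y 0)‖ * Δt)) *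
            ‖SDRE.lyapunovSol (SDRE.closedLoop A (SDRE.gainF B R) Q (y t))‖ := by gcongr
        _ = _ := by ring
    have h2 : SDRE.closedLoop A (SDRE.gainF B R) Q (y t) + (A (y (t + Δt)) - A (y t)) =
        A (y (t + Δt)) - SDRE.gainF B R * SDRE.riccatiSol (A (y t)) (SDRE.gainF B R) Q := by
      rw [SDRE.closedLoop]
      abel
    rwa [h2] at h1
  have hsym := SDRE.transpose_eq_of_posSemidef hPt.1
  refine ⟨hs, hP _ (hyΩ _ hmT),
    SDRE.existsUnique_isNewtonKleinman (hdet _ (hyΩ _ hmT)) hQ hR hsym hs, fun X hX => ?_⟩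
  obtain ⟨P, hPsol, hlim⟩ := hX.exists_tendsto (hdet _ (hyΩ _ hmT)) hQ hR hsym hs
  rwa [hPsol.unique hPT (hdet _ (hyΩ _ hmT)) hQ hFp] at hlim
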